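/- Let $0\le m\le n-1$ be integers, and put $G:=\{x\in\mathbb R^n:x_{m+1}=\dots=x_n=0\}$, $E:=(-1,1)^n\setminus G$. For a set $S$, $d_S$ denotes the distance to $S$, and $P_G$ is the nearest-point projection onto $G$. For $b,\theta>0$ and $v\in E$, with $v':=P_G(v)$, $v'':=v-v'$, let $$\Psi(v):=\Bigl\{w\in E:\ 0<d_G(w)<b\,d_G(v),\ (w-v')\cdot\tfrac{v''}{\|v''\|}>\cos\theta\,\|w-v'\|\Bigr\}.$$ Let $\Gamma_0\subset\mathbb R^n$, $\beta>n$, $0<\nu<1$, and let $\gamma_0\ge 0$ be a measurable function on $\mathbb R^n\setminus\Gamma_0$. Assume: (i) There are $1\le K_0<\infty$, a bounded open set $U_0$ and a $C^2$ bijection $g:(-1,1)^n\to U_0$ with $C^2$ inverse such that $g((-1,1)^n\cap G)=U_0\cap\Gamma_0$; $g(P_G(v))=P_{\Gamma_0}(g(v))$ for all $v\in(-1,1)^n$, where $P_{\Gamma_0}$ sends each point of $U_0$ to a nearest point of $\Gamma_0$; and $\|\partial g\|\le K_0$ on $(-1,1)^n$, $\|\partial g^{-1}\|\le K_0$ on $U_0$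 (operator norms), $\|\partial^2g\|\le\frac12K_0^{-1}$ on $(-1,1)^n$ (Euclidean norm of the tensor of second partial derivatives). If $n-m\ge16$, assume in addition that there is $\kappa$ with $\|\partial^2 g\|\le\kappa$ on $(-1,1)^n$ and $\kappa\sqrt{n-m}<2K_0^{-1}$. (ii) There is $K_3<\infty$ with $1\le d_{\Gamma_0}(x)^\beta\gamma_0(x)\le K_3$ for all $x\in U_0\setminus\Gamma_0$. For $x\in U_0\setminus\Gamma_0$ put $\Psi_0(x):=g(\Psi(g^{-1}(x)))$, and $\Psi_0^{-1}(y):=\{x\in U_0\setminus\Gamma_0:y\in\Psi_0(x)\}$. Then there are $0<b_0<\frac1{\sqrt{n-m}}$ and $0<\theta_0<\frac\pi4$ such that for all $0<b\le b_0$ and $0<\theta\le\theta_0$: for all $x\in U_0\setminus\Gamma_0$, $|\Psi_0(x)|>0$, $$|\Psi_0(x)|^{-1}\le n^{n/2}K_0^n\,|\Psi(g^{-1}(x))|^{-1},\qquad \Psi_0(x)\subseteq B_{d_{\Gamma_0}(x)}(x),$$ and for all $y\in U_0\setminus\Gamma_0$, $$\int_{\Psi_0^{-1}(y)}\frac{\gamma_0(x)}{|\Psi_0(x)|}\,dx\le\nu\,\gamma_0(y).$$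 -/

import Mathlib

open MeasureTheory

noncomputable section

namespace LowDim

/-- Euclidean `n`-space. -/
abbrev Eucl (n : ℕ) : Type := EuclideanSpace ℝ (Fin n)

/-- The open cube `(-1,1)^n`. -/
def cube (n : ℕ) : Set (Eucl n) := {x | ∀ i, x i ∈ Set.Ioo (-1 : ℝ) 1}

/-- The coordinate `m`-plane `G` on which all coordinates but the first `m` vanish. -/
def coordPlane (n m : ℕ) : Set (Eucl n) := {x | ∀ i : Fin n, m ≤ i.val → x i = 0}

/-- The nearest-point projection onto `coordPlane n m`: it keeps the first `m` coordinates and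
replaces the others by zero. -/
def projPlane (n m : ℕ) (x : Eucl n) : Eucl n :=
  WithLp.toLp 2 (fun i : Fin n => if i.val < m then x i else 0)

/-- `P` sends each point of `U` to a point of `S` that is nearest to it. -/
def IsMetricProjectionOn {n : ℕ} (S U : Set (Eucl n)) (P : Eucl n → Eucl n) : Prop :=
  ∀ x ∈ U, P x ∈ S ∧ ‖x - P x‖ = Metric.infDist x S

/-- The annular neighborhood `A_r(S)` of the points with distance to `S` in `(0,r)`. -/
def annulus {n : ℕ} (r : ℝ) (S : Set (Eucl n)) : Set (Eucl n) :=
  {x | Metric.infDist x S ∈ Set.Ioo 0 r}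

/-- The open cone with vertex `x`, axis direction `ω` and aperture `2θ`. -/
def cone {n : ℕ} (θ : ℝ) (x ω : Eucl n) : Set (Eucl n) :=
  {y | Real.cos θ * ‖y - x‖ < inner ℝ (y - x) ω}

/-- The direction `z / ‖z‖` of a nonzero vector `z`. -/
def direction {n : ℕ} (z : Eucl n) : Eucl n := ‖z‖⁻¹ • z

/-- The flat cone correspondence on `E = (-1,1)^n \ G`: with `x' = P_G x` and `x'' = x - x'`,
`Ψ(x) = E ∩ A_{b d_G(x)}(G) ∩ C_θ(x'; x''/‖x''‖)`. -/
def flatCorr (n m : ℕ) (b θ : ℝ) (x : Eucl n) : Set (Eucl n) :=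
  (cube n \ coordPlane n m) ∩
    annulus (b * Metric.infDist x (coordPlane n m)) (coordPlane n m) ∩
    cone θ (projPlane n m x) (direction (x - projPlane n m x))

/-- The transported correspondence `Ψ₀(x) = g(Ψ(g⁻¹(x)))`, with `ginv` in the role of `g⁻¹`. -/
def transCorr (n m : ℕ) (g ginv : Eucl n → Eucl n) (b θ : ℝ) (x : Eucl n) : Set (Eucl n) :=
  g '' flatCorr n m b θ (ginv x)

/-- The inverse of a correspondence `Ψ` with domain `D`. -/
def corrInv {n : ℕ} (D : Set (Eucl n)) (Ψ : Eucl n → Set (Eucl n)) (y : Eucl n) :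
    Set (Eucl n) :=
  {x | x ∈ D ∧ y ∈ Ψ x}

/-- The Euclidean norm of the third-order tensor `(∂ᵢ∂ⱼ gₖ(v))` of second partial derivatives. -/
def secondDerivNorm {n : ℕ} (g : Eucl n → Eucl n) (v : Eucl n) : ℝ :=
  Real.sqrt (∑ i : Fin n, ∑ j : Fin n, ∑ k : Fin n,
    (iteratedFDeriv ℝ 2 g v ![EuclideanSpace.single i 1, EuclideanSpace.single j 1] k) ^ 2)

end LowDim

end

/-!
Everything is pulled back by the chart to the flat picture, where the projection onto the plane and
the distance `‖perp n m v‖` to it are explicit.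

*Chart.* The second-order Taylor remainder of `g` along a normal segment from `projPlane n m v` to
`v` is at most `κ / 2 * √(n - m)` times the length of the segment, whereas its linear part is
expanded by at least `K⁻¹`. Since `κ * √(n - m) < 2 * K⁻¹`, which for `n - m < 16` already holds with
`κ = 1 / 2 * K⁻¹`, the distance to `Γ` is comparable to the distance to the plane before transport
(`IsFlatChart.le_infDist`, `IsFlatChart.infDist_le`). For small parameters, a point `w` of the cone
about `v` satisfies that `g w - g p` is short and at a uniformly acute angle to `g v - g p`, where `p`
is the foot point of `v`; this puts `g w` into the required ball
(`IsFlatChart.transCorr_subset_ball`). Volumes change by at most the factor `K ^ n` under `g` and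
`ginv` (`volume_image_le`).

*Integral.* The volume of a truncated cone is never computed, so that no power of the aperture has to
be tracked. It does not depend on the axis (`volume_truncCone_congr`), it scales with the power `n`
(`volume_truncCone_mul`), and at least the fraction `2 ^ (-n)` of it lies in the cube
(`volume_truncCone_le_flatCorr`); this bounds `Ψ(v)` from below. Conversely, the points `v` with
`w ∈ Ψ(v)` lie in a cone of the same aperture about `w` (`sub_projPlane_mem_truncCone_swap`), at
distance more than `R = ‖perp n m w‖ / b` from the plane. In each dyadic layer
`2 ^ j * R ≤ ‖perp n m v‖ < 2 ^ (j + 1) * R` the two cone volumes cancel up to the factor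
`(4 * K ^ 2 / b) ^ n` (`IsFlatChart.setLIntegral_layer_le`), and the
weight contributes `(2 ^ j * R) ^ (-β)`. The sum over the layers is a constant times
`b ^ (β - n) * ‖perp n m w‖ ^ (-β)`, where the last factor is bounded by the weight at `g w` and, as
`n < β`, the first is as small as desired.
-/

open scoped Pointwise

noncomputable section

namespace LowDim

variable {n m : ℕ}

/-! ### The coordinate plane and its orthogonal complement -/

/-- The component of `x` orthogonal to `coordPlane n m`. -/
def perp (n m : ℕ) (x : Eucl n) : Eucl n := x - projPlane n m x

/-- The cone with vertex `0`, axis direction `e` and aperture `2θ`, truncated at distance `r` from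
`coordPlane n m`. -/
def truncCone (n m : ℕ) (θ : ℝ) (e : Eucl n) (r : ℝ) : Set (Eucl n) :=
  {h | ‖perp n m h‖ < r ∧ Real.cos θ * ‖h‖ < inner ℝ h e}

@[simp] lemma projPlane_apply (x : Eucl n) (i : Fin n) :
    projPlane n m x i = if i.val < m then x i else 0 := rfl

@[simp] lemma perp_apply (x : Eucl n) (i : Fin n) :
    perp n m x i = if i.val < m then 0 else x i := by
  simp only [perp, PiLp.sub_apply, projPlane_apply]
  split_ifs <;> simp

lemma projPlane_add_perp (x : Eucl n) : projPlane n m x + perp n m x = x := by simp [perp]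

lemma perp_sub (x y : Eucl n) : perp n m (x - y) = perp n m x - perp n m y := by
  ext i; simp only [perp_apply, PiLp.sub_apply]; split_ifs <;> simp

lemma perp_smul (c : ℝ) (x : Eucl n) : perp n m (c • x) = c • perp n m x := by
  ext i; simp only [perp_apply, PiLp.smul_apply]; split_ifs <;> simp

lemma projPlane_sub (x y : Eucl n) :
    projPlane n m (x - y) = projPlane n m x - projPlane n m y := by
  ext i; simp only [projPlane_apply, PiLp.sub_apply]; split_ifs <;> simp

@[simp] lemma perp_projPlane (x : Eucl n) : perp n m (projPlane n m x) = 0 := by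
  ext i; simp only [perp_apply, projPlane_apply]; split_ifs <;> simp

@[simp] lemma perp_perp (x : Eucl n) : perp n m (perp n m x) = perp n m x := by
  ext i; simp only [perp_apply]; split_ifs <;> simp

@[simp] lemma projPlane_projPlane (x : Eucl n) :
    projPlane n m (projPlane n m x) = projPlane n m x := by
  ext i; simp only [projPlane_apply]; split_ifs <;> simp

lemma inner_projPlane_perp (x y : Eucl n) : inner ℝ (projPlane n m x) (perp n m y) = 0 := by
  rw [PiLp.inner_apply]
  refine Finset.sum_eq_zero fun i _ => ?_
  simp only [perp_apply, projPlane_apply]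
  split_ifs <;> simp

lemma inner_perp_right (x y : Eucl n) :
    inner ℝ x (perp n m y) = inner ℝ (perp n m x) (perp n m y) := by
  conv_lhs => rw [← projPlane_add_perp (m := m) x, inner_add_left, inner_projPlane_perp, zero_add]

lemma norm_sq_eq_projPlane_add_perp (x : Eucl n) :
    ‖x‖ ^ 2 = ‖projPlane n m x‖ ^ 2 + ‖perp n m x‖ ^ 2 := by
  conv_lhs => rw [← projPlane_add_perp (m := m) x]
  rw [norm_add_sq_real, inner_projPlane_perp]; ring

lemma norm_perp_le (x : Eucl n) : ‖perp n m x‖ ≤ ‖x‖ := by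
  refine le_of_sq_le_sq ?_ (norm_nonneg _)
  have := norm_sq_eq_projPlane_add_perp (m := m) x
  nlinarith [sq_nonneg ‖projPlane n m x‖]

lemma continuous_perp : Continuous (perp n m) := by
  refine (LipschitzWith.of_dist_le_mul (K := 1) fun x y => ?_).continuous
  simpa [dist_eq_norm, ← perp_sub] using norm_perp_le (m := m) (x - y)

lemma mem_coordPlane_iff (x : Eucl n) : x ∈ coordPlane n m ↔ perp n m x = 0 := by
  constructor
  · intro h; ext i
    simp only [perp_apply, PiLp.zero_apply]
    split_ifs with hi
    · rfl
    · exact h i (not_lt.1 hi)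
  · intro h i hi
    have := congrArg (fun z : Eucl n => z i) h
    simpa [not_lt.2 hi] using this

lemma projPlane_mem_coordPlane (x : Eucl n) : projPlane n m x ∈ coordPlane n m := by
  simp [mem_coordPlane_iff]

lemma infDist_coordPlane (x : Eucl n) :
    Metric.infDist x (coordPlane n m) = ‖perp n m x‖ := by
  apply le_antisymm
  · simpa [dist_eq_norm, perp] using
      Metric.infDist_le_dist_of_mem (x := x) (projPlane_mem_coordPlane (m := m) x)
  · refine (Metric.le_infDist ⟨_, projPlane_mem_coordPlane (m := m) x⟩).2 fun y hy => ?_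
    rw [dist_eq_norm]
    have := norm_perp_le (m := m) (x - y)
    rwa [perp_sub, (mem_coordPlane_iff y).1 hy, sub_zero] at this

lemma projPlane_mem_cube {x : Eucl n} (hx : x ∈ cube n) : projPlane n m x ∈ cube n := by
  intro i
  simp only [projPlane_apply]
  split_ifs
  · exact hx i
  · simp

lemma isOpen_cube : IsOpen (cube n) := by
  simp only [cube, Set.ofPred_forall]
  exact isOpen_iInter_of_finite fun i =>
    isOpen_Ioo.preimage (PiLp.continuous_apply 2 (fun _ : Fin n => ℝ) i)

lemma convex_cube : Convex ℝ (cube n) := by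
  simp only [cube, Set.ofPred_forall]
  exact convex_iInter fun i =>
    (convex_Ioo (-1 : ℝ) 1).is_linear_preimage ⟨fun _ _ => rfl, fun _ _ => rfl⟩

lemma norm_perp_le_sqrt (hm : m < n) {x : Eucl n} (hx : x ∈ cube n) :
    ‖perp n m x‖ ≤ √((n : ℝ) - m) := by
  rw [EuclideanSpace.norm_eq]
  apply Real.sqrt_le_sqrt
  have hcard : ∑ i : Fin n, (if i.val < m then (0 : ℝ) else 1) = (n : ℝ) - m := by
    rw [Fin.sum_univ_eq_sum_range (fun i => if i < m then (0 : ℝ) else 1) n,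
      ← Finset.sum_range_add_sum_Ico _ hm.le, Finset.sum_eq_zero, Finset.sum_congr rfl
        (g := fun _ => (1 : ℝ))]
    · simp [Nat.cast_sub hm.le]
    · intro i hi; simp [not_lt.2 (Finset.mem_Ico.1 hi).1]
    · intro i hi; simp [Finset.mem_range.1 hi]
  rw [← hcard]
  refine Finset.sum_le_sum fun i _ => ?_
  simp only [perp_apply]
  split_ifs
  · simp
  · have := hx i
    rw [Real.norm_eq_abs, sq_abs]
    nlinarith [this.1, this.2]

/-! ### Volumes of truncated cones -/

lemma isOpen_truncCone (θ : ℝ) (e : Eucl n) (r : ℝ) : IsOpen (truncCone n m θ e r) := by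
  have := continuous_perp (n := n) (m := m)
  have h1 : IsOpen {h : Eucl n | ‖perp n m h‖ < r} := isOpen_lt (by fun_prop) (by fun_prop)
  have h2 : IsOpen {h : Eucl n | Real.cos θ * ‖h‖ < inner ℝ h e} :=
    isOpen_lt (by fun_prop) (by fun_prop)
  exact h1.inter h2

lemma norm_mul_cos_lt {θ : ℝ} {e h : Eucl n} {r : ℝ} (he : ‖e‖ = 1) (hep : perp n m e = e)
    (hh : h ∈ truncCone n m θ e r) : Real.cos θ * ‖h‖ < r := by
  refine hh.2.trans_le ?_
  rw [← hep, inner_perp_right, hep]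
  refine (real_inner_le_norm _ _).trans ?_
  rw [he, mul_one]
  exact hh.1.le

lemma volume_truncCone_ne_top {θ : ℝ} (hθ : 0 < Real.cos θ) {e : Eucl n} (he : ‖e‖ = 1)
    (hep : perp n m e = e) (r : ℝ) : volume (truncCone n m θ e r) ≠ ⊤ := by
  refine ((measure_mono fun h hh => ?_).trans_lt
    (measure_ball_lt_top (x := (0 : Eucl n)) (r := r / Real.cos θ))).ne
  rw [mem_ball_zero_iff, lt_div_iff₀ hθ, mul_comm]
  exact norm_mul_cos_lt he hep hh

lemma volume_truncCone_pos {θ : ℝ} (hθ : Real.cos θ < 1) {e : Eucl n} (he : ‖e‖ = 1)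
    (hep : perp n m e = e) {r : ℝ} (hr : 0 < r) : 0 < volume (truncCone n m θ e r) := by
  refine (isOpen_truncCone θ e r).measure_pos _ ⟨(r / 2) • e, ?_, ?_⟩
  · rw [perp_smul, hep, norm_smul, he, Real.norm_of_nonneg (by positivity)]; linarith
  · rw [norm_smul, he, real_inner_smul_left, real_inner_self_eq_norm_sq, he,
      Real.norm_of_nonneg (by positivity)]
    nlinarith

lemma volume_truncCone_mul {θ : ℝ} (e : Eucl n) {c : ℝ} (hc : 0 < c) (r : ℝ) :
    volume (truncCone n m θ e (c * r)) =
      ENNReal.ofReal (c ^ n) * volume (truncCone n m θ e r) := by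
  have : truncCone n m θ e (c * r) = c • truncCone n m θ e r := by
    ext h
    rw [Set.mem_smul_set_iff_inv_smul_mem₀ hc.ne']
    simp only [truncCone, Set.mem_ofPred_eq, perp_smul, norm_smul, real_inner_smul_left, norm_inv,
      Real.norm_of_nonneg hc.le]
    refine and_congr ?_ ?_
    · rw [inv_mul_lt_iff₀ hc]
    · rw [mul_left_comm, mul_lt_mul_iff_right₀ (inv_pos.2 hc)]
  rw [this, Measure.addHaar_smul]
  simp [abs_of_pos hc]

/-- Truncated cones with unit axes orthogonal to the plane have the same volume: the reflection that
exchanges the axes fixes the plane. -/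
lemma volume_truncCone_congr {θ : ℝ} {e e' : Eucl n} (he : ‖e‖ = 1) (he' : ‖e'‖ = 1)
    (hep : perp n m e = e) (hep' : perp n m e' = e') (r : ℝ) :
    volume (truncCone n m θ e r) = volume (truncCone n m θ e' r) := by
  set R := (Submodule.span ℝ {e - e'})ᗮ.reflection with hR
  have hRe : R e = e' := Submodule.reflection_sub (by rw [he, he'])
  have hperp : ∀ h, ‖perp n m (R h)‖ = ‖perp n m h‖ := by
    intro h
    have hmem : R h - h ∈ Submodule.span ℝ {e - e'} := by
      have h1 := Submodule.sub_starProjection_mem_orthogonal (K := (Submodule.span ℝ {e - e'})ᗮ) h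
      rw [Submodule.orthogonal_orthogonal] at h1
      have : R h - h = (-2 : ℝ) • (h - (Submodule.span ℝ {e - e'})ᗮ.starProjection h) := by
        rw [hR, Submodule.reflection_apply]; module
      rw [this]
      exact Submodule.smul_mem _ _ h1
    obtain ⟨c, hc⟩ := Submodule.mem_span_singleton.1 hmem
    have h2 : perp n m (R h - h) = R h - h := by
      rw [← hc, perp_smul, perp_sub, hep, hep']
    have h3 : projPlane n m (R h) = projPlane n m h := by
      rw [perp, sub_eq_self, projPlane_sub, sub_eq_zero] at h2
      exact h2
    have h4 := norm_sq_eq_projPlane_add_perp (m := m) (R h)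
    have h5 := norm_sq_eq_projPlane_add_perp (m := m) h
    rw [h3, R.norm_map] at h4
    exact (sq_eq_sq₀ (norm_nonneg _) (norm_nonneg _)).1 (by linarith)
  have : truncCone n m θ e r = R ⁻¹' truncCone n m θ e' r := by
    ext h
    simp only [truncCone, Set.mem_preimage, Set.mem_ofPred_eq, hperp, R.norm_map]
    rw [← hRe, R.inner_map_map]
  rw [this]
  exact R.measurePreserving.measure_preimage
    (isOpen_truncCone θ e' r).measurableSet.nullMeasurableSet

/-! ### Volumes of images -/

lemma abs_det_le_pow (L : Eucl n →L[ℝ] Eucl n) {K : ℝ} (hL : ‖L‖ ≤ K) :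
    ENNReal.ofReal |L.det| ≤ ENNReal.ofReal (K ^ n) := by
  have hK : 0 ≤ K := (norm_nonneg _).trans hL
  have h1 : volume (L '' Metric.closedBall 0 1) ≤ volume (Metric.closedBall (0 : Eucl n) K) := by
    refine measure_mono ?_
    rintro _ ⟨x, hx, rfl⟩
    rw [mem_closedBall_zero_iff] at hx ⊢
    exact (L.le_opNorm x).trans (by nlinarith [norm_nonneg x, norm_nonneg L])
  rw [Measure.addHaar_image_continuousLinearMap, Measure.addHaar_closedBall' _ _ hK,
    finrank_euclideanSpace_fin] at h1
  exact (ENNReal.mul_le_mul_iff_left (Metric.measure_closedBall_pos _ _ one_pos).ne'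
    measure_closedBall_lt_top.ne).1 h1

lemma volume_image_le {f : Eucl n → Eucl n} {U A : Set (Eucl n)} (hU : IsOpen U)
    (hf : DifferentiableOn ℝ f U) {K : ℝ} (hK : ∀ x ∈ U, ‖fderiv ℝ f x‖ ≤ K)
    (hA : MeasurableSet A) (hAU : A ⊆ U) :
    volume (f '' A) ≤ ENNReal.ofReal (K ^ n) * volume A := by
  refine (addHaar_image_le_lintegral_abs_det_fderiv volume hA (f' := fderiv ℝ f)
    fun x hx => ((hf x (hAU hx)).differentiableAt
      (hU.mem_nhds (hAU hx))).hasFDerivAt.hasFDerivWithinAt).trans ?_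
  refine (setLIntegral_mono measurable_const
    fun x hx => abs_det_le_pow _ (hK x (hAU hx))).trans ?_
  rw [setLIntegral_const]

/-! ### The flat correspondence -/

lemma norm_direction {z : Eucl n} (hz : z ≠ 0) : ‖direction z‖ = 1 := by
  rw [direction, norm_smul, norm_inv, norm_norm, inv_mul_cancel₀ (norm_ne_zero_iff.2 hz)]

lemma perp_direction_perp (z : Eucl n) :
    perp n m (direction (perp n m z)) = direction (perp n m z) := by
  rw [direction, perp_smul, perp_perp]

lemma perp_ne_zero {v : Eucl n} (hv : v ∉ coordPlane n m) : perp n m v ≠ 0 :=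
  fun h => hv ((mem_coordPlane_iff v).2 h)

lemma perp_sub_projPlane (v w : Eucl n) : perp n m (w - projPlane n m v) = perp n m w := by
  rw [perp_sub, perp_projPlane, sub_zero]

lemma mem_flatCorr_iff {b θ : ℝ} {v w : Eucl n} (hθ : 0 ≤ Real.cos θ) :
    w ∈ flatCorr n m b θ v ↔ w ∈ cube n ∧
      w - projPlane n m v ∈
        truncCone n m θ (direction (perp n m v)) (b * ‖perp n m v‖) := by
  simp only [flatCorr, annulus, cone, infDist_coordPlane, Set.mem_inter_iff, Set.mem_sdiff,
    Set.mem_ofPred_eq, truncCone, perp_sub_projPlane, Set.mem_Ioo]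
  constructor
  · rintro ⟨⟨⟨h1, h2⟩, h3, h4⟩, h5⟩
    exact ⟨h1, h4, h5⟩
  · rintro ⟨h1, h4, h5⟩
    -- a point of the cone cannot lie in the plane, as it would be orthogonal to the axis
    have h0 : perp n m w ≠ 0 := by
      intro h0
      change _ < inner ℝ _ (direction (perp n m v)) at h5
      rw [← perp_direction_perp, inner_perp_right, perp_sub_projPlane, h0, inner_zero_left] at h5
      exact absurd h5 (not_lt.2 (by positivity))
    exact ⟨⟨⟨h1, fun h => h0 ((mem_coordPlane_iff w).1 h)⟩, norm_pos_iff.2 h0, h4⟩, h5⟩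

lemma isOpen_flatCorr {b θ : ℝ} (hθ : 0 ≤ Real.cos θ) (v : Eucl n) :
    IsOpen (flatCorr n m b θ v) := by
  have : flatCorr n m b θ v = cube n ∩ (fun w => w - projPlane n m v) ⁻¹'
      truncCone n m θ (direction (perp n m v)) (b * ‖perp n m v‖) := by
    ext w; exact mem_flatCorr_iff hθ
  rw [this]
  exact isOpen_cube.inter ((isOpen_truncCone _ _ _).preimage (by fun_prop))

lemma flatCorr_subset_cube {b θ : ℝ} {v : Eucl n} : flatCorr n m b θ v ⊆ cube n :=
  fun _ hw => hw.1.1.1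

/-- The isometry that changes the signs of the coordinates selected by `s`. -/
def signFlip (s : Fin n → Bool) : Eucl n ≃ₗᵢ[ℝ] Eucl n :=
  LinearIsometryEquiv.piLpCongrRight 2
    fun i => if s i then LinearIsometryEquiv.neg ℝ else LinearIsometryEquiv.refl ℝ ℝ

lemma signFlip_apply (s : Fin n → Bool) (x : Eucl n) (i : Fin n) :
    signFlip s x i = if s i then -x i else x i := by
  simp only [signFlip, LinearIsometryEquiv.piLpCongrRight_apply]
  split_ifs <;> simp

/-- Near the boundary, the cube cuts off at most a fixed fraction of the cone: the cone is invariant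
under sign changes of the first `m` coordinates, and one of these moves a given point of the cone,
translated by `projPlane n m v`, into the cube. -/
lemma volume_truncCone_le_flatCorr {b θ : ℝ} (hθ : 1 / 2 ≤ Real.cos θ) {v : Eucl n}
    (hv : v ∈ cube n) (hvG : v ∉ coordPlane n m) (hb : b * ‖perp n m v‖ ≤ 1 / 2) :
    volume (truncCone n m θ (direction (perp n m v)) (b * ‖perp n m v‖)) ≤
      2 ^ n * volume (flatCorr n m b θ v) := by
  set e := direction (perp n m v)
  set r := b * ‖perp n m v‖
  have he : ‖e‖ = 1 := norm_direction (perp_ne_zero hvG)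
  have hep : perp n m e = e := perp_direction_perp v
  have hcover : truncCone n m θ e r ⊆ ⋃ s : Fin n → Bool,
      signFlip s ⁻¹' ((fun h => projPlane n m v + h) ⁻¹' flatCorr n m b θ v) := by
    intro h hh
    have hlt : ‖h‖ < 1 := by
      have := norm_mul_cos_lt he hep hh
      nlinarith [norm_nonneg h]
    have hi : ∀ i, |h i| < 1 := fun i => (PiLp.norm_apply_le h i).trans_lt hlt
    let s : Fin n → Bool := fun i => decide (i.val < m ∧ 0 < v i * h i)
    have hs : ∀ i : Fin n, m ≤ i.val → signFlip s h i = h i := by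
      intro i hi
      rw [signFlip_apply, if_neg]
      simp [s, not_lt.2 hi]
    have hsp : perp n m (signFlip s h) = perp n m h := by
      ext i
      simp only [perp_apply]
      split_ifs with hi
      · rfl
      · exact hs i (not_lt.1 hi)
    refine Set.mem_iUnion.2 ⟨s, ?_⟩
    change projPlane n m v + signFlip s h ∈ flatCorr n m b θ v
    rw [mem_flatCorr_iff (by linarith), add_sub_cancel_left]
    refine ⟨fun i => ?_, ?_, ?_⟩
    · rw [PiLp.add_apply, projPlane_apply]
      obtain ⟨h1, h2⟩ := abs_lt.1 (hi i)
      obtain ⟨h3, h4⟩ := hv i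
      by_cases him : i.val < m
      · rw [if_pos him, signFlip_apply]
        by_cases hpos : 0 < v i * h i
        · rw [if_pos (by simp [s, him, hpos])]
          rcases pos_and_pos_or_neg_and_neg_of_mul_pos hpos with ⟨h5, h6⟩ | ⟨h5, h6⟩ <;>
            constructor <;> linarith
        · rw [if_neg (by simp [s, hpos])]
          rcases mul_nonpos_iff.1 (not_lt.1 hpos) with ⟨h5, h6⟩ | ⟨h5, h6⟩ <;>
            constructor <;> linarith
      · rw [if_neg him, hs i (not_lt.1 him), zero_add]
        exact ⟨h1, h2⟩
    · rw [hsp]; exact hh.1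
    · rw [LinearIsometryEquiv.norm_map]
      change _ < inner ℝ _ e
      rw [← hep, inner_perp_right, hsp, ← inner_perp_right, hep]
      exact hh.2
  have hopen := isOpen_flatCorr (b := b) (θ := θ) (by linarith) (m := m) v
  calc volume (truncCone n m θ e r) ≤ ∑ s : Fin n → Bool, volume (signFlip s ⁻¹'
        ((fun h => projPlane n m v + h) ⁻¹' flatCorr n m b θ v)) :=
        (measure_mono hcover).trans (measure_iUnion_fintype_le _ _)
    _ = ∑ s : Fin n → Bool, volume (flatCorr n m b θ v) := by
        refine Finset.sum_congr rfl fun s _ => ?_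
        rw [(signFlip s).measurePreserving.measure_preimage
          (hopen.preimage (by fun_prop)).measurableSet.nullMeasurableSet, measure_preimage_add]
    _ = 2 ^ n * volume (flatCorr n m b θ v) := by simp

/-- If `w` is nearer to the plane than `v` and lies in the cone with vertex `projPlane n m v` and the
normal direction of `v` as axis, then `v` lies in the corresponding cone of `w`: both conditions
bound the same inner product of the normal components from below, and the second one by less. -/
lemma sub_projPlane_mem_truncCone_swap {b θ r : ℝ} (hθ : 0 ≤ Real.cos θ) {v w : Eucl n}
    (hb : b ≤ 1) (hv : perp n m v ≠ 0) (hw : perp n m w ≠ 0) (hr : ‖perp n m v‖ < r)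
    (h : w - projPlane n m v ∈
      truncCone n m θ (direction (perp n m v)) (b * ‖perp n m v‖)) :
    v - projPlane n m w ∈ truncCone n m θ (direction (perp n m w)) r := by
  obtain ⟨h1, h2⟩ := h
  have hv0 := norm_pos_iff.2 hv
  have hw0 := norm_pos_iff.2 hw
  rw [perp_sub_projPlane] at h1
  have hle : ‖perp n m w‖ ≤ ‖perp n m v‖ := h1.le.trans (mul_le_of_le_one_left hv0.le hb)
  refine ⟨by rwa [perp_sub_projPlane], ?_⟩
  change _ < inner ℝ _ _ at h2
  rw [direction, inner_smul_right, inner_perp_right, perp_sub_projPlane,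
    lt_inv_mul_iff₀ hv0] at h2
  rw [direction, inner_smul_right, inner_perp_right, perp_sub_projPlane,
    lt_inv_mul_iff₀ hw0, real_inner_comm]
  refine lt_of_le_of_lt ?_ h2
  rw [mul_left_comm, mul_left_comm ‖perp n m v‖]
  refine mul_le_mul_of_nonneg_left (le_of_sq_le_sq ?_ (by positivity)) hθ
  have e1 := norm_sq_eq_projPlane_add_perp (m := m) (w - projPlane n m v)
  have e2 := norm_sq_eq_projPlane_add_perp (m := m) (v - projPlane n m w)
  rw [perp_sub_projPlane, projPlane_sub, projPlane_projPlane] at e1 e2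
  rw [norm_sub_rev (projPlane n m v)] at e2
  rw [mul_pow, mul_pow, e1, e2]
  have hsq : ‖perp n m w‖ ^ 2 ≤ ‖perp n m v‖ ^ 2 := by gcongr
  nlinarith [mul_le_mul_of_nonneg_left hsq (sq_nonneg ‖projPlane n m w - projPlane n m v‖)]

/-! ### Second-order estimates for the chart -/

lemma norm_apply_sq_le {F : Type*} [NormedAddCommGroup F] [NormedSpace ℝ F]
    (L : Eucl n →L[ℝ] F) (x : Eucl n) :
    ‖L x‖ ^ 2 ≤ ‖x‖ ^ 2 * ∑ i, ‖L (EuclideanSpace.single i 1)‖ ^ 2 := by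
  have hx : x = ∑ i, x i • EuclideanSpace.single i (1 : ℝ) := by
    simpa using ((EuclideanSpace.basisFun (Fin n) ℝ).sum_repr x).symm
  have h1 : ‖L x‖ ≤ ∑ i, ‖x i‖ * ‖L (EuclideanSpace.single i 1)‖ := by
    conv_lhs => rw [hx, map_sum]
    refine (norm_sum_le _ _).trans (Finset.sum_le_sum fun i _ => ?_)
    rw [map_smul, norm_smul]
  rw [EuclideanSpace.norm_sq_eq]
  exact (pow_le_pow_left₀ (norm_nonneg _) h1 2).trans (Finset.sum_mul_sq_le_sq_mul_sq _ _ _)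

lemma norm_fderiv_fderiv_le (g : Eucl n → Eucl n) (v : Eucl n) :
    ‖fderiv ℝ (fderiv ℝ g) v‖ ≤ secondDerivNorm g v := by
  refine ContinuousLinearMap.opNorm_le_bound _ (Real.sqrt_nonneg _) fun x => ?_
  refine ContinuousLinearMap.opNorm_le_bound _
    (mul_nonneg (Real.sqrt_nonneg _) (norm_nonneg _)) fun y => ?_
  refine le_of_sq_le_sq ?_
    (mul_nonneg (mul_nonneg (Real.sqrt_nonneg _) (norm_nonneg _)) (norm_nonneg _))
  rw [mul_pow, mul_pow, secondDerivNorm, Real.sq_sqrt (by positivity)]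
  set B := fderiv ℝ (fderiv ℝ g) v
  have hB : ∀ i j, ∑ k, (iteratedFDeriv ℝ 2 g v
      ![EuclideanSpace.single i 1, EuclideanSpace.single j 1] k) ^ 2 =
      ‖B (EuclideanSpace.single i 1) (EuclideanSpace.single j 1)‖ ^ 2 := by
    intro i j
    rw [EuclideanSpace.norm_sq_eq, iteratedFDeriv_two_apply]
    simp [B]
  simp_rw [hB]
  calc ‖B x y‖ ^ 2 ≤ ‖y‖ ^ 2 * ∑ j, ‖B x (EuclideanSpace.single j 1)‖ ^ 2 :=
        norm_apply_sq_le (B x) y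
    _ ≤ ‖y‖ ^ 2 * ∑ j, ‖x‖ ^ 2 *
          ∑ i, ‖B (EuclideanSpace.single i 1) (EuclideanSpace.single j 1)‖ ^ 2 := by
        gcongr with j
        exact norm_apply_sq_le (B.flip (EuclideanSpace.single j 1)) x
    _ = _ := by
        rw [← Finset.mul_sum, Finset.sum_comm]; ring

lemma norm_taylor_le {g : Eucl n → Eucl n} {κ : ℝ} (hg : ContDiffOn ℝ 2 g (cube n))
    (hκ : ∀ v ∈ cube n, secondDerivNorm g v ≤ κ) {p u : Eucl n} (hp : p ∈ cube n)
    (hu : u ∈ cube n) :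
    ‖g u - g p - fderiv ℝ g p (u - p)‖ ≤ κ / 2 * ‖u - p‖ ^ 2 := by
  set h := u - p with hh
  have hseg : ∀ t ∈ Set.Icc (0 : ℝ) 1, p + t • h ∈ cube n := by
    intro t ht
    exact convex_cube.add_smul_sub_mem hp hu ht
  have hlip : ∀ z ∈ cube n, ‖fderiv ℝ g z - fderiv ℝ g p‖ ≤ κ * ‖z - p‖ := by
    intro z hz
    refine convex_cube.norm_image_sub_le_of_norm_fderiv_le (fun x hx => ?_)
      (fun x hx => (norm_fderiv_fderiv_le g x).trans (hκ x hx)) hp hz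
    have h1 : ContDiffOn ℝ 1 (fderiv ℝ g) (cube n) :=
      hg.fderiv_of_isOpen isOpen_cube (by norm_num)
    exact (h1.differentiableOn one_ne_zero x hx).differentiableAt (isOpen_cube.mem_nhds hx)
  have hderiv : ∀ t ∈ Set.Icc (0 : ℝ) 1, HasDerivAt
      (fun t : ℝ => g (p + t • h) - g p - t • fderiv ℝ g p h)
      (fderiv ℝ g (p + t • h) h - fderiv ℝ g p h) t := by
    intro t ht
    have h1 : HasFDerivAt g (fderiv ℝ g (p + t • h)) (p + t • h) :=
      ((hg.differentiableOn two_ne_zero _ (hseg t ht)).differentiableAt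
        (isOpen_cube.mem_nhds (hseg t ht))).hasFDerivAt
    have h2 : HasDerivAt (fun t : ℝ => p + t • h) h t := by
      simpa using ((hasDerivAt_id t).smul_const h).const_add p
    have h3 : HasDerivAt (fun t : ℝ => t • fderiv ℝ g p h) (fderiv ℝ g p h) t := by
      simpa using (hasDerivAt_id t).smul_const (fderiv ℝ g p h)
    exact ((h1.comp_hasDerivAt t h2).sub_const _).sub h3
  have key := image_norm_le_of_norm_deriv_right_le_deriv_boundary (a := (0 : ℝ)) (b := 1)
    (f := fun t : ℝ => g (p + t • h) - g p - t • fderiv ℝ g p h)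
    (f' := fun t => fderiv ℝ g (p + t • h) h - fderiv ℝ g p h)
    (B := fun t => κ / 2 * ‖h‖ ^ 2 * t ^ 2) (B' := fun t => κ * ‖h‖ ^ 2 * t)
    (fun t ht => (hderiv t ht).continuousAt.continuousWithinAt)
    (fun t ht => (hderiv t (Set.Ico_subset_Icc_self ht)).hasDerivWithinAt)
    (by simp)
    (fun t => by
      have := (hasDerivAt_pow 2 t).const_mul (κ / 2 * ‖h‖ ^ 2)
      exact this.congr_deriv (by push_cast; ring))
    (fun t ht => by
      have ht' := Set.Ico_subset_Icc_self ht
      rw [← sub_apply]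
      refine (ContinuousLinearMap.le_opNorm _ _).trans ?_
      have := hlip _ (hseg t ht')
      rw [add_sub_cancel_left, norm_smul, Real.norm_of_nonneg ht'.1] at this
      nlinarith [mul_le_mul_of_nonneg_right this (norm_nonneg h)])
    (Set.right_mem_Icc.2 zero_le_one)
  simpa [hh] using key

/-- A vector of the cone with unit axis `e` and aperture `2θ` differs from the multiple of `e` of the
same length by at most `θ` times this length, the chord being shorter than the arc. -/
lemma norm_sub_smul_le {θ : ℝ} {h e : Eucl n} (he : ‖e‖ = 1) (hθ : 0 ≤ θ)
    (hcone : Real.cos θ * ‖h‖ < inner ℝ h e) : ‖h - ‖h‖ • e‖ ≤ θ * ‖h‖ := by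
  refine le_of_sq_le_sq ?_ (by positivity)
  rw [norm_sub_sq_real, inner_smul_right, norm_smul, he, norm_norm]
  have := Real.one_sub_sq_div_two_le_cos (x := θ)
  have h0 := norm_nonneg h
  nlinarith [mul_le_mul_of_nonneg_left hcone.le h0,
    mul_le_mul_of_nonneg_right this (sq_nonneg ‖h‖)]

/-- A `C²` chart `g` with inverse `ginv` that flattens `Γ` to `coordPlane n m`, in the form in which
it enters the estimates: `K` bounds the first derivatives in both directions, `κ` the second
derivatives, `κ` is small enough for `g` to be dominated by its linearization on the normal
segments, and distances to `Γ` are attained along the images of these segments. -/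
structure IsFlatChart (n m : ℕ) (Γ U : Set (Eucl n)) (g ginv : Eucl n → Eucl n) (K κ : ℝ) :
    Prop where
  lt : m < n
  one_le : 1 ≤ K
  nonneg : 0 ≤ κ
  small : κ * √((n : ℝ) - m) < 2 * K⁻¹
  isOpen : IsOpen U
  bijOn : Set.BijOn g (cube n) U
  invOn : Set.InvOn ginv g (cube n) U
  contDiffOn : ContDiffOn ℝ 2 g (cube n)
  contDiffOn_inv : ContDiffOn ℝ 2 ginv U
  flat : g '' (cube n ∩ coordPlane n m) = U ∩ Γ
  infDist_eq : ∀ v ∈ cube n, Metric.infDist (g v) Γ = ‖g v - g (projPlane n m v)‖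
  norm_fderiv_le : ∀ v ∈ cube n, ‖fderiv ℝ g v‖ ≤ K
  norm_fderiv_inv_le : ∀ x ∈ U, ‖fderiv ℝ ginv x‖ ≤ K
  secondDeriv_le : ∀ v ∈ cube n, secondDerivNorm g v ≤ κ

/-- The lower bound for the expansion of `g` along the normal segments. -/
def expansion (n m : ℕ) (K κ : ℝ) : ℝ := K⁻¹ - κ / 2 * √((n : ℝ) - m)

namespace IsFlatChart

variable {Γ U : Set (Eucl n)} {g ginv : Eucl n → Eucl n} {K κ : ℝ}

lemma expansion_pos (H : IsFlatChart n m Γ U g ginv K κ) : 0 < expansion n m K κ := by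
  have := H.small
  unfold expansion
  linarith

lemma expansion_le (H : IsFlatChart n m Γ U g ginv K κ) : expansion n m K κ ≤ K⁻¹ := by
  have := mul_nonneg H.nonneg (Real.sqrt_nonneg ((n : ℝ) - m))
  unfold expansion
  linarith

lemma norm_image_sub_le (H : IsFlatChart n m Γ U g ginv K κ) {u p : Eucl n} (hu : u ∈ cube n)
    (hp : p ∈ cube n) : ‖g u - g p‖ ≤ K * ‖u - p‖ :=
  convex_cube.norm_image_sub_le_of_norm_fderiv_le
    (fun x hx => (H.contDiffOn.differentiableOn two_ne_zero x hx).differentiableAt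
      (isOpen_cube.mem_nhds hx)) H.norm_fderiv_le hp hu

/-- The derivative of `g` expands by at least `K⁻¹`, since the derivative of `ginv` inverts it. -/
lemma norm_le_mul_norm_fderiv (H : IsFlatChart n m Γ U g ginv K κ) {p : Eucl n}
    (hp : p ∈ cube n) (k : Eucl n) : ‖k‖ ≤ K * ‖fderiv ℝ g p k‖ := by
  have hgp := H.bijOn.mapsTo hp
  have h1 := ((H.contDiffOn.differentiableOn two_ne_zero p hp).differentiableAt
    (isOpen_cube.mem_nhds hp)).hasFDerivAt
  have h2 := ((H.contDiffOn_inv.differentiableOn two_ne_zero _ hgp).differentiableAt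
    (H.isOpen.mem_nhds hgp)).hasFDerivAt
  have h3 := h2.comp p h1
  have h4 : HasFDerivAt (ginv ∘ g) (ContinuousLinearMap.id ℝ (Eucl n)) p :=
    (hasFDerivAt_id p).congr_of_eventuallyEq
      (Filter.eventuallyEq_of_mem (isOpen_cube.mem_nhds hp) fun x hx => H.invOn.1 hx)
  have h5 := congrArg (fun L => L k) (h3.unique h4)
  simp only [ContinuousLinearMap.comp_apply, ContinuousLinearMap.id_apply] at h5
  conv_lhs => rw [← h5]
  exact (ContinuousLinearMap.le_opNorm _ _).trans
    (mul_le_mul_of_nonneg_right (H.norm_fderiv_inv_le _ hgp) (norm_nonneg _))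

lemma infDist_le (H : IsFlatChart n m Γ U g ginv K κ) {v : Eucl n} (hv : v ∈ cube n) :
    Metric.infDist (g v) Γ ≤ K * ‖perp n m v‖ := by
  rw [H.infDist_eq v hv]
  exact H.norm_image_sub_le hv (projPlane_mem_cube hv)

/-- The second-order remainder along a normal segment is at most `κ / 2 * √(n - m)` times the
length of the segment. -/
lemma norm_remainder_le (H : IsFlatChart n m Γ U g ginv K κ) {v : Eucl n} (hv : v ∈ cube n) :
    ‖g v - g (projPlane n m v) - fderiv ℝ g (projPlane n m v) (perp n m v)‖ ≤
      κ / 2 * √((n : ℝ) - m) * ‖perp n m v‖ := by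
  refine (norm_taylor_le H.contDiffOn H.secondDeriv_le (projPlane_mem_cube hv) hv).trans ?_
  change κ / 2 * ‖perp n m v‖ ^ 2 ≤ _
  have := H.nonneg
  have h1 := norm_perp_le_sqrt H.lt hv
  rw [sq, mul_assoc]
  gcongr

lemma le_infDist (H : IsFlatChart n m Γ U g ginv K κ) {v : Eucl n} (hv : v ∈ cube n) :
    expansion n m K κ * ‖perp n m v‖ ≤ Metric.infDist (g v) Γ := by
  rw [H.infDist_eq v hv]
  have h1 := H.norm_remainder_le hv
  have h2 := H.norm_le_mul_norm_fderiv (projPlane_mem_cube (m := m) hv) (perp n m v)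
  rw [← inv_mul_le_iff₀ (zero_lt_one.trans_le H.one_le)] at h2
  have h3 := norm_sub_norm_le (fderiv ℝ g (projPlane n m v) (perp n m v))
    (g v - g (projPlane n m v))
  rw [norm_sub_rev (fderiv ℝ g _ _)] at h3
  unfold expansion
  linarith

/-- The normal displacement `g v - g p` and the image `A` of the normal direction under the
linearization at the foot point `p` form an acute angle, bounded away from a right angle. -/
lemma le_inner_fderiv_direction (H : IsFlatChart n m Γ U g ginv K κ) {v : Eucl n}
    (hv : v ∈ cube n) (hvG : v ∉ coordPlane n m) :
    expansion n m K κ * K⁻¹ * ‖perp n m v‖ ≤ inner ℝ (g v - g (projPlane n m v))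
      (fderiv ℝ g (projPlane n m v) (direction (perp n m v))) := by
  have hK := zero_lt_one.trans_le H.one_le
  have hk := norm_pos_iff.2 (perp_ne_zero hvG)
  have hc := H.expansion_pos
  set k := perp n m v
  set A := fderiv ℝ g (projPlane n m v)
  set a := g v - g (projPlane n m v)
  have h1 : ‖a - A k‖ ≤ κ / 2 * √((n : ℝ) - m) * ‖k‖ := H.norm_remainder_le hv
  have h2 : ‖k‖ ≤ K * ‖A k‖ := H.norm_le_mul_norm_fderiv (projPlane_mem_cube hv) k
  rw [← inv_mul_le_iff₀ hK] at h2
  have h3 : inner ℝ a (A k) = inner ℝ (a - A k) (A k) + ‖A k‖ ^ 2 := by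
    rw [inner_sub_left a, real_inner_self_eq_norm_sq]; ring
  have h4 := (abs_le.1 (abs_real_inner_le_norm (a - A k) (A k))).1
  have h5 : expansion n m K κ * ‖k‖ ≤ ‖A k‖ - ‖a - A k‖ := by
    unfold expansion
    linarith
  rw [direction, map_smul, inner_smul_right, le_inv_mul_iff₀ hk]
  have hAk : 0 ≤ ‖A k‖ := norm_nonneg _
  calc ‖k‖ * (expansion n m K κ * K⁻¹ * ‖k‖) = (expansion n m K κ * ‖k‖) * (K⁻¹ * ‖k‖) := by ring
    _ ≤ (‖A k‖ - ‖a - A k‖) * ‖A k‖ := by gcongr; exact (mul_nonneg hc.le hk.le).trans h5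
    _ ≤ inner ℝ a (A k) := by rw [h3]; linarith

/-- For small parameters, `g w - g p` is short in comparison with `g v - g p`, where `p` is the
foot point of `v`, and the two form an acute angle; hence `g w` is nearer to `g v` than `g p`. -/
lemma transCorr_subset_ball (H : IsFlatChart n m Γ U g ginv K κ) {b θ : ℝ}
    (hb : 0 < b) (hb' : b ≤ expansion n m K κ / (8 * K ^ 3))
    (hθ : 0 ≤ θ) (hθ' : θ ≤ expansion n m K κ / (4 * K ^ 3)) (hcos : 1 / 2 ≤ Real.cos θ)
    {v w : Eucl n} (hv : v ∈ cube n) (hvG : v ∉ coordPlane n m)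
    (hw : w ∈ flatCorr n m b θ v) : g w ∈ Metric.ball (g v) (Metric.infDist (g v) Γ) := by
  rw [mem_flatCorr_iff (by linarith)] at hw
  obtain ⟨hwc, hwT⟩ := hw
  have hp := projPlane_mem_cube (m := m) hv
  have hK := zero_lt_one.trans_le H.one_le
  have hc := H.expansion_pos
  have hk := norm_pos_iff.2 (perp_ne_zero hvG)
  have he := norm_direction (perp_ne_zero hvG)
  have hsmall := H.small
  have hks := norm_perp_le_sqrt H.lt hv
  have hinner := H.le_inner_fderiv_direction hv hvG
  have ha := H.norm_image_sub_le hv hp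
  have hcn := H.norm_image_sub_le hwc hp
  have htay := norm_taylor_le H.contDiffOn H.secondDeriv_le hp hwc
  have hA := H.norm_fderiv_le _ hp
  have ht2 := norm_mul_cos_lt he (perp_direction_perp v) hwT
  have hhe := norm_sub_smul_le he hθ hwT.2
  rw [Metric.mem_ball, dist_eq_norm, H.infDist_eq v hv]
  change ‖g v - g (projPlane n m v)‖ ≤ K * ‖perp n m v‖ at ha
  set p := projPlane n m v
  set k := perp n m v
  set e := direction k
  set h := w - p
  set A := fderiv ℝ g p
  set a := g v - g p
  set c := g w - g p
  set c₀ := expansion n m K κ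
  have hh0 : 0 < ‖h‖ := by
    refine norm_pos_iff.2 fun h0 => ?_
    have h1 : Real.cos θ * ‖h‖ < inner ℝ h e := hwT.2
    simp [h0] at h1
  have ht : ‖h‖ < 2 * (b * ‖k‖) := by nlinarith
  -- `c` is close to the multiple `‖h‖ • A e` of the image of the normal direction
  have hcA : ‖c - ‖h‖ • A e‖ ≤ κ / 2 * ‖h‖ ^ 2 + K * (θ * ‖h‖) := by
    have h1 : c - ‖h‖ • A e = (c - A h) + A (h - ‖h‖ • e) := by
      rw [A.map_sub h, map_smul]; abel
    rw [h1]
    refine (norm_add_le _ _).trans (add_le_add htay ?_)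
    exact (A.le_opNorm _).trans (mul_le_mul hA hhe (norm_nonneg _) hK.le)
  have hac : ‖h‖ * (c₀ * K⁻¹ * ‖k‖) -
      K * ‖k‖ * (κ / 2 * ‖h‖ ^ 2 + K * (θ * ‖h‖)) ≤ inner ℝ a c := by
    have h1 : inner ℝ a c = ‖h‖ * inner ℝ a (A e) + inner ℝ a (c - ‖h‖ • A e) := by
      rw [inner_sub_right a c, inner_smul_right]; ring
    have h2 := (abs_le.1 (abs_real_inner_le_norm a (c - ‖h‖ • A e))).1
    have h3 : ‖a‖ * ‖c - ‖h‖ • A e‖ ≤ K * ‖k‖ * (κ / 2 * ‖h‖ ^ 2 + K * (θ * ‖h‖)) :=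
      mul_le_mul ha hcA (norm_nonneg _) (by positivity)
    have h4 := mul_le_mul_of_nonneg_left hinner hh0.le
    rw [h1]
    linarith
  have hθK : K * (K * θ) ≤ c₀ * K⁻¹ / 4 := by
    rw [le_div_iff₀ (by positivity)] at hθ'
    rw [le_div_iff₀ four_pos, ← div_eq_mul_inv, le_div_iff₀ hK]
    nlinarith
  have hbK : 2 * (K * K * b) ≤ c₀ * K⁻¹ / 4 := by
    rw [le_div_iff₀ (by positivity)] at hb'
    rw [le_div_iff₀ four_pos, ← div_eq_mul_inv, le_div_iff₀ hK]
    nlinarith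
  have hκK : K * (κ / 2 * ‖h‖) ≤ c₀ * K⁻¹ / 4 := by
    have h1 : κ * ‖k‖ ≤ 2 * K⁻¹ := (mul_le_mul_of_nonneg_left hks H.nonneg).trans hsmall.le
    have h2 : κ / 2 * ‖h‖ ≤ 2 * b * K⁻¹ := by
      have h3 := mul_le_mul_of_nonneg_left ht.le H.nonneg
      have h4 := mul_le_mul_of_nonneg_left h1 hb.le
      linarith
    have h3 : K * (κ / 2 * ‖h‖) ≤ 2 * b := by
      refine (mul_le_mul_of_nonneg_left h2 hK.le).trans_eq ?_
      field_simp
    nlinarith [H.one_le, mul_le_mul H.one_le H.one_le zero_le_one hK.le]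
  have hcc : ‖c‖ ^ 2 < 2 * inner ℝ a c := by
    have h1 : ‖c‖ ^ 2 ≤ K ^ 2 * ‖h‖ ^ 2 := by
      rw [← mul_pow]; exact pow_le_pow_left₀ (norm_nonneg _) hcn 2
    have h2 : K ^ 2 * ‖h‖ ^ 2 < ‖h‖ * ‖k‖ * (c₀ * K⁻¹ / 4) := by
      calc K ^ 2 * ‖h‖ ^ 2 = K ^ 2 * ‖h‖ * ‖h‖ := by ring
        _ < K ^ 2 * ‖h‖ * (2 * (b * ‖k‖)) := by gcongr
        _ = ‖h‖ * ‖k‖ * (2 * (K * K * b)) := by ring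
        _ ≤ _ := by gcongr
    have h3 : K * ‖k‖ * (κ / 2 * ‖h‖ ^ 2 + K * (θ * ‖h‖)) ≤
        ‖h‖ * ‖k‖ * (c₀ * K⁻¹ / 2) := by
      calc _ = ‖h‖ * ‖k‖ * (K * (κ / 2 * ‖h‖) + K * (K * θ)) := by ring
        _ ≤ _ := by gcongr; linarith
    have h4 : 0 < ‖h‖ * ‖k‖ * (c₀ * K⁻¹) := by positivity
    linarith
  have hca : g w - g v = c - a := by simp only [c, a]; abel
  rw [hca]
  refine lt_of_pow_lt_pow_left₀ 2 (norm_nonneg _) ?_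
  rw [norm_sub_sq_real, real_inner_comm]
  linarith

end IsFlatChart

/-! ### The integral estimate -/

lemma ennreal_inv_le_mul_inv {a c t : ENNReal} (hc : c ≠ 0) (hc' : c ≠ ⊤) (h : a ≤ c * t) :
    t⁻¹ ≤ c * a⁻¹ := by
  have h1 := ENNReal.inv_le_inv.2 h
  rw [ENNReal.mul_inv (Or.inl hc) (Or.inl hc')] at h1
  calc t⁻¹ = c * (c⁻¹ * t⁻¹) := by rw [← mul_assoc, ENNReal.mul_inv_cancel hc hc', one_mul]
    _ ≤ c * a⁻¹ := by gcongr

namespace IsFlatChart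

variable {Γ U : Set (Eucl n)} {g ginv : Eucl n → Eucl n} {K κ : ℝ}

lemma ginv_mem (H : IsFlatChart n m Γ U g ginv K κ) {x : Eucl n} (hx : x ∈ U \ Γ) :
    ginv x ∈ cube n ∧ ginv x ∉ coordPlane n m ∧ g (ginv x) = x := by
  obtain ⟨v, hv, rfl⟩ := H.bijOn.surjOn hx.1
  have hgv : ginv (g v) = v := H.invOn.1 hv
  rw [hgv]
  refine ⟨hv, fun hG => hx.2 ?_, rfl⟩
  have : g v ∈ U ∩ Γ := H.flat ▸ Set.mem_image_of_mem g ⟨hv, hG⟩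
  exact this.2

lemma infDist_pos (H : IsFlatChart n m Γ U g ginv K κ) {x : Eucl n} (hx : x ∈ U \ Γ) :
    0 < Metric.infDist x Γ := by
  obtain ⟨h1, h2, h3⟩ := H.ginv_mem hx
  rw [← h3]
  exact (mul_pos H.expansion_pos (norm_pos_iff.2 (perp_ne_zero h2))).trans_le (H.le_infDist h1)

lemma volume_flatCorr_le (H : IsFlatChart n m Γ U g ginv K κ) {b θ : ℝ}
    (hθ : 0 ≤ Real.cos θ) (x : Eucl n) :
    volume (flatCorr n m b θ (ginv x)) ≤
      ENNReal.ofReal (K ^ n) * volume (transCorr n m g ginv b θ x) := by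
  set A := flatCorr n m b θ (ginv x)
  have hA : A ⊆ cube n := flatCorr_subset_cube
  have himg : g '' A = U ∩ ginv ⁻¹' A := by
    ext z
    constructor
    · rintro ⟨u, hu, rfl⟩
      refine ⟨H.bijOn.mapsTo (hA hu), ?_⟩
      rwa [Set.mem_preimage, H.invOn.1 (hA hu)]
    · rintro ⟨hz, hu⟩
      exact ⟨ginv z, hu, H.invOn.2 hz⟩
  have hmeas : MeasurableSet (g '' A) := by
    rw [himg]
    exact (H.contDiffOn_inv.continuousOn.isOpen_inter_preimage H.isOpen
      (isOpen_flatCorr hθ _)).measurableSet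
  have hsub : A ⊆ ginv '' (g '' A) := fun u hu =>
    ⟨g u, Set.mem_image_of_mem g hu, H.invOn.1 (hA hu)⟩
  refine (measure_mono hsub).trans (volume_image_le H.isOpen
    (H.contDiffOn_inv.differentiableOn two_ne_zero) H.norm_fderiv_inv_le hmeas ?_)
  rw [himg]
  exact Set.inter_subset_left

lemma mem_flatCorr_of_mem_corrInv (H : IsFlatChart n m Γ U g ginv K κ) {b θ : ℝ} {w x : Eucl n}
    (hw : w ∈ cube n) (hx : x ∈ corrInv (U \ Γ) (transCorr n m g ginv b θ) (g w)) :
    x ∈ U \ Γ ∧ w ∈ flatCorr n m b θ (ginv x) := by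
  obtain ⟨hxU, u, hu, hgu⟩ := hx
  exact ⟨hxU, H.bijOn.injOn (flatCorr_subset_cube hu) hw hgu ▸ hu⟩

/-- The preimages of the points `x` with `g w ∈ transCorr n m g ginv b θ x` lie in a cone about
`w`. -/
lemma volume_layer_le (H : IsFlatChart n m Γ U g ginv K κ) {b θ ρ : ℝ}
    (hb : 0 < b) (hb1 : b ≤ 1) (hcos : 0 < Real.cos θ)
    {w : Eucl n} (hw : w ∈ cube n) (hwG : w ∉ coordPlane n m) :
    volume (corrInv (U \ Γ) (transCorr n m g ginv b θ) (g w) ∩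
        {x | ρ ≤ ‖perp n m (ginv x)‖ ∧ ‖perp n m (ginv x)‖ < 2 * ρ}) ≤
      ENNReal.ofReal (K ^ n) * (ENNReal.ofReal ((2 / b) ^ n) *
        volume (truncCone n m θ (direction (perp n m w)) (b * ρ))) := by
  set T := truncCone n m θ (direction (perp n m w)) (2 * ρ) with hT
  set B := cube n ∩ (fun v => v + -projPlane n m w) ⁻¹' T
  have hSB : corrInv (U \ Γ) (transCorr n m g ginv b θ) (g w) ∩
      {x | ρ ≤ ‖perp n m (ginv x)‖ ∧ ‖perp n m (ginv x)‖ < 2 * ρ} ⊆ g '' B := by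
    rintro x ⟨hx, -, hx2⟩
    obtain ⟨hxU, hxw⟩ := H.mem_flatCorr_of_mem_corrInv hw hx
    obtain ⟨hv, hvG, hgv⟩ := H.ginv_mem hxU
    refine ⟨ginv x, ⟨hv, ?_⟩, hgv⟩
    rw [Set.mem_preimage, ← sub_eq_add_neg]
    exact sub_projPlane_mem_truncCone_swap hcos.le hb1 (perp_ne_zero hvG)
      (perp_ne_zero hwG) hx2 ((mem_flatCorr_iff hcos.le).1 hxw).2
  have hB : MeasurableSet B :=
    (isOpen_cube.inter ((isOpen_truncCone _ _ _).preimage (by fun_prop))).measurableSet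
  have hvB : volume B ≤ volume T :=
    (measure_mono Set.inter_subset_right).trans_eq (measure_preimage_add_right _ _ _)
  have hvT : volume T = ENNReal.ofReal ((2 / b) ^ n) *
      volume (truncCone n m θ (direction (perp n m w)) (b * ρ)) := by
    have h1 : 2 * ρ = 2 / b * (b * ρ) := by field_simp
    rw [hT, h1, volume_truncCone_mul _ (by positivity)]
  rw [← hvT]
  exact (measure_mono hSB).trans ((volume_image_le isOpen_cube
    (H.contDiffOn.differentiableOn two_ne_zero) H.norm_fderiv_le hB
    Set.inter_subset_left).trans (mul_le_mul' le_rfl hvB))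

/-- The contribution of the points whose preimages have distance between `ρ` and `2 * ρ` to the
plane. These preimages lie in a truncated cone congruent, up to the factor `2 / b`, to one that
bounds the volumes of the correspondence from below, so that the volume of the cone cancels. -/
lemma setLIntegral_layer_le (H : IsFlatChart n m Γ U g ginv K κ) {b θ β K₃ ρ : ℝ}
    {γ : Eucl n → ℝ} (hβ : 0 < β) (hK₃ : 0 ≤ K₃) (hb : 0 < b) (hb1 : b ≤ 1)
    (hbs : b * √((n : ℝ) - m) ≤ 1 / 2) (hcos : 1 / 2 ≤ Real.cos θ) (hcos1 : Real.cos θ < 1)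
    (hγ : ∀ x ∈ U \ Γ, Metric.infDist x Γ ^ β * γ x ≤ K₃) (hρ : 0 < ρ)
    {w : Eucl n} (hw : w ∈ cube n) (hwG : w ∉ coordPlane n m) :
    ∫⁻ x in corrInv (U \ Γ) (transCorr n m g ginv b θ) (g w) ∩
        {x | ρ ≤ ‖perp n m (ginv x)‖ ∧ ‖perp n m (ginv x)‖ < 2 * ρ},
        ENNReal.ofReal (γ x) / volume (transCorr n m g ginv b θ x) ≤
      ENNReal.ofReal (K₃ * (expansion n m K κ * ρ) ^ (-β) * (4 ^ n * K ^ (2 * n) / b ^ n)) := by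
  have hK := zero_lt_one.trans_le H.one_le
  have hc := H.expansion_pos
  have hcos0 : 0 < Real.cos θ := by linarith
  set e := direction (perp n m w) with hedef
  have he : ‖e‖ = 1 := norm_direction (perp_ne_zero hwG)
  have hep : perp n m e = e := perp_direction_perp w
  set X := volume (truncCone n m θ e (b * ρ)) with hX
  have hX0 : X ≠ 0 := (volume_truncCone_pos hcos1 he hep (by positivity)).ne'
  have hXt : X ≠ ⊤ := volume_truncCone_ne_top hcos0 he hep _
  set S := corrInv (U \ Γ) (transCorr n m g ginv b θ) (g w) ∩
    {x | ρ ≤ ‖perp n m (ginv x)‖ ∧ ‖perp n m (ginv x)‖ < 2 * ρ} with hS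
  have hpoint : ∀ x ∈ S, ENNReal.ofReal (γ x) / volume (transCorr n m g ginv b θ x) ≤
      ENNReal.ofReal (K₃ * (expansion n m K κ * ρ) ^ (-β)) *
        (ENNReal.ofReal (2 ^ n * K ^ n) * X⁻¹) := by
    rintro x ⟨⟨hxU, -⟩, hx1, -⟩
    obtain ⟨hv, hvG, hgv⟩ := H.ginv_mem hxU
    have hd := H.infDist_pos hxU
    rw [div_eq_mul_inv]
    refine mul_le_mul' (ENNReal.ofReal_le_ofReal ?_) (ennreal_inv_le_mul_inv ?_
      ENNReal.ofReal_ne_top ?_)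
    · have h1 := hγ x hxU
      rw [← le_div_iff₀' (by positivity), div_eq_mul_inv, ← Real.rpow_neg hd.le] at h1
      refine h1.trans (mul_le_mul_of_nonneg_left ?_ hK₃)
      refine Real.rpow_le_rpow_of_nonpos (by positivity) ?_ (by linarith)
      have h2 := H.le_infDist hv
      rw [hgv] at h2
      exact (mul_le_mul_of_nonneg_left hx1 hc.le).trans h2
    · exact (ENNReal.ofReal_pos.2 (by positivity)).ne'
    · have hb2 : b * ‖perp n m (ginv x)‖ ≤ 1 / 2 :=
        (mul_le_mul_of_nonneg_left (norm_perp_le_sqrt H.lt hv) hb.le).trans hbs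
      calc X = volume (truncCone n m θ (direction (perp n m (ginv x))) (b * ρ)) :=
            volume_truncCone_congr he (norm_direction (perp_ne_zero hvG)) hep
              (perp_direction_perp _) _
        _ ≤ volume (truncCone n m θ (direction (perp n m (ginv x)))
              (b * ‖perp n m (ginv x)‖)) :=
            measure_mono fun h hh => ⟨hh.1.trans_le (by gcongr), hh.2⟩
        _ ≤ 2 ^ n * volume (flatCorr n m b θ (ginv x)) :=
            volume_truncCone_le_flatCorr hcos hv hvG hb2
        _ ≤ 2 ^ n * (ENNReal.ofReal (K ^ n) * volume (transCorr n m g ginv b θ x)) := by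
            gcongr
            exact H.volume_flatCorr_le hcos0.le x
        _ = ENNReal.ofReal (2 ^ n * K ^ n) * volume (transCorr n m g ginv b θ x) := by
            rw [← mul_assoc, ENNReal.ofReal_mul (by positivity), ENNReal.ofReal_pow zero_le_two]
            simp
  have hvol : volume S ≤ ENNReal.ofReal (K ^ n) * (ENNReal.ofReal ((2 / b) ^ n) * X) :=
    H.volume_layer_le hb hb1 hcos0 hw hwG
  refine (setLIntegral_mono measurable_const hpoint).trans ?_
  rw [setLIntegral_const]
  refine (mul_le_mul_right hvol _).trans_eq ?_
  calc _ = ENNReal.ofReal (K₃ * (expansion n m K κ * ρ) ^ (-β)) *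
        ENNReal.ofReal (2 ^ n * K ^ n) * ENNReal.ofReal (K ^ n) * ENNReal.ofReal ((2 / b) ^ n) *
        (X⁻¹ * X) := by ring
    _ = _ := by
      rw [ENNReal.inv_mul_cancel hX0 hXt, mul_one, ← ENNReal.ofReal_mul (by positivity),
        ← ENNReal.ofReal_mul (by positivity), ← ENNReal.ofReal_mul (by positivity)]
      congr 1
      have h4 : (4 : ℝ) ^ n = 2 ^ n * 2 ^ n := by rw [← mul_pow]; norm_num
      rw [h4, div_pow, two_mul, pow_add]
      ring

/-- Summation over the dyadic layers `R * 2 ^ j ≤ ‖perp n m (ginv x)‖ < R * 2 ^ (j + 1)`, where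
`R = ‖perp n m w‖ / b` is the least distance from the plane that occurs. -/
lemma setLIntegral_corrInv_le (H : IsFlatChart n m Γ U g ginv K κ) {b θ β K₃ : ℝ}
    {γ : Eucl n → ℝ} (hβ : 1 ≤ β) (hK₃ : 0 ≤ K₃) (hb : 0 < b) (hb1 : b ≤ 1)
    (hbs : b * √((n : ℝ) - m) ≤ 1 / 2) (hcos : 1 / 2 ≤ Real.cos θ) (hcos1 : Real.cos θ < 1)
    (hγ : ∀ x ∈ U \ Γ, Metric.infDist x Γ ^ β * γ x ≤ K₃)
    {w : Eucl n} (hw : w ∈ cube n) (hwG : w ∉ coordPlane n m) :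
    ∫⁻ x in corrInv (U \ Γ) (transCorr n m g ginv b θ) (g w),
        ENNReal.ofReal (γ x) / volume (transCorr n m g ginv b θ x) ≤
      ENNReal.ofReal (2 * K₃ * expansion n m K κ ^ (-β) * 4 ^ n * K ^ (2 * n) *
        b ^ (β - n) * ‖perp n m w‖ ^ (-β)) := by
  have hK := zero_lt_one.trans_le H.one_le
  have hc := H.expansion_pos
  have hcos0 : 0 < Real.cos θ := by linarith
  have hw0 := norm_pos_iff.2 (perp_ne_zero hwG)
  set R := ‖perp n m w‖ / b with hR
  have hR0 : 0 < R := by positivity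
  set S := corrInv (U \ Γ) (transCorr n m g ginv b θ) (g w)
  set f := fun x => ENNReal.ofReal (γ x) / volume (transCorr n m g ginv b θ x)
  set L : ℕ → Set (Eucl n) := fun j => S ∩
    {x | R * 2 ^ j ≤ ‖perp n m (ginv x)‖ ∧ ‖perp n m (ginv x)‖ < 2 * (R * 2 ^ j)}
  have hcover : S ⊆ ⋃ j, L j := by
    intro x hx
    have h1 := ((mem_flatCorr_iff hcos0.le).1 (H.mem_flatCorr_of_mem_corrInv hw hx).2).2.1
    rw [perp_sub_projPlane] at h1
    have h2 : 1 ≤ ‖perp n m (ginv x)‖ / R := by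
      rw [one_le_div hR0, hR, div_le_iff₀ hb]
      linarith
    obtain ⟨j, hj1, hj2⟩ := exists_nat_pow_near h2 (one_lt_two : (1 : ℝ) < 2)
    refine Set.mem_iUnion.2 ⟨j, hx, ?_, ?_⟩
    · rw [le_div_iff₀ hR0] at hj1; linarith
    · rw [div_lt_iff₀ hR0, pow_succ] at hj2; linarith
  set M := K₃ * expansion n m K κ ^ (-β) * 4 ^ n * K ^ (2 * n) *
        b ^ (β - n) * ‖perp n m w‖ ^ (-β) with hM
  have hM0 : 0 ≤ M := by positivity
  have hlayer : ∀ j, ∫⁻ x in L j, f x ≤ ENNReal.ofReal (M * (1 / 2) ^ j) := by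
    intro j
    refine (H.setLIntegral_layer_le (by linarith) hK₃ hb hb1 hbs hcos hcos1 hγ
      (ρ := R * 2 ^ j) (by positivity) hw hwG).trans (ENNReal.ofReal_le_ofReal ?_)
    have h1 : (expansion n m K κ * (R * 2 ^ j)) ^ (-β) = expansion n m K κ ^ (-β) *
        (‖perp n m w‖ ^ (-β) * b ^ β * ((2 : ℝ) ^ j) ^ (-β)) := by
      rw [Real.mul_rpow hc.le (by positivity), Real.mul_rpow hR0.le (by positivity), hR,
        Real.div_rpow hw0.le hb.le, Real.rpow_neg hb.le, div_inv_eq_mul]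
    have h2 : ((2 : ℝ) ^ j) ^ (-β) ≤ (1 / 2) ^ j := by
      calc ((2 : ℝ) ^ j) ^ (-β) ≤ ((2 : ℝ) ^ j) ^ (-1 : ℝ) :=
            Real.rpow_le_rpow_of_exponent_le (one_le_pow₀ one_le_two) (by linarith)
        _ = (1 / 2) ^ j := by rw [Real.rpow_neg_one, one_div, inv_pow]
    have h3 : b ^ (β - n) = b ^ β / b ^ n := by
      rw [Real.rpow_sub hb, Real.rpow_natCast]
    calc _ = K₃ * expansion n m K κ ^ (-β) * 4 ^ n * K ^ (2 * n) *
        b ^ (β - n) * ‖perp n m w‖ ^ (-β) * ((2 : ℝ) ^ j) ^ (-β) := by rw [h1, h3]; ring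
      _ ≤ M * (1 / 2) ^ j := by gcongr
  calc ∫⁻ x in S, f x ≤ ∫⁻ x in ⋃ j, L j, f x := lintegral_mono_set hcover
    _ ≤ ∑' j, ∫⁻ x in L j, f x := lintegral_iUnion_le _ _
    _ ≤ ∑' j, ENNReal.ofReal (M * (1 / 2) ^ j) := ENNReal.tsum_le_tsum hlayer
    _ = ENNReal.ofReal (∑' j : ℕ, M * (1 / 2) ^ j) :=
        (ENNReal.ofReal_tsum_of_nonneg (fun j => by positivity)
          (summable_geometric_two.mul_left M)).symm
    _ = _ := by
        rw [tsum_mul_left, tsum_geometric_two, hM]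
        congr 1; ring

end IsFlatChart

/-- In codimension below `16` the bound `1 / 2 * K⁻¹` for the second derivatives is itself small
enough. -/
lemma exists_secondDeriv_bound {K : ℝ} (hK : 1 ≤ K) {g : Eucl n → Eucl n}
    (hD2g : ∀ v ∈ cube n, secondDerivNorm g v ≤ 1 / 2 * K⁻¹)
    (hcodim : m + 16 ≤ n → ∃ κ : ℝ, κ * √((n : ℝ) - m) < 2 * K⁻¹ ∧
      ∀ v ∈ cube n, secondDerivNorm g v ≤ κ) :
    ∃ κ : ℝ, 0 ≤ κ ∧ κ * √((n : ℝ) - m) < 2 * K⁻¹ ∧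
      ∀ v ∈ cube n, secondDerivNorm g v ≤ κ := by
  by_cases h : m + 16 ≤ n
  · obtain ⟨κ, h1, h2⟩ := hcodim h
    exact ⟨κ, (Real.sqrt_nonneg _).trans (h2 0 fun i => by simp), h1, h2⟩
  · have hK' : 0 < K⁻¹ := by positivity
    refine ⟨1 / 2 * K⁻¹, by positivity, ?_, hD2g⟩
    have h16 : (n : ℝ) < m + 16 := by exact_mod_cast not_le.1 h
    have hs : √((n : ℝ) - m) < 4 := by
      rw [Real.sqrt_lt' (by norm_num)]; linarith
    nlinarith

end LowDim

end

open LowDim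

theorem corollaryC (n m : ℕ) (hm : m < n)
    (Γ₀ U₀ : Set (LowDim.Eucl n)) (β ν K₀ K₃ : ℝ) (hβ : (n : ℝ) < β)
    (hν₀ : 0 < ν) (hν₁ : ν < 1) (hK₀ : 1 ≤ K₀)
    (γ₀ : LowDim.Eucl n → ℝ)
    (hγ_meas : AEMeasurable γ₀ (volume.restrict Γ₀ᶜ)) (hγ_nonneg : ∀ x ∉ Γ₀, 0 ≤ γ₀ x)
    (hU_open : IsOpen U₀) (hU_bdd : Bornology.IsBounded U₀)
    -- the chart `g` of class `C²`, with inverse `ginv` of class `C²`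
    (g ginv : LowDim.Eucl n → LowDim.Eucl n)
    (hg_bij : Set.BijOn g (LowDim.cube n) U₀)
    (hg_inv : Set.InvOn ginv g (LowDim.cube n) U₀)
    (hg_smooth : ContDiffOn ℝ 2 g (LowDim.cube n))
    (hginv_smooth : ContDiffOn ℝ 2 ginv U₀)
    -- it flattens `Γ₀` and commutes with the nearest-point projections
    (hg_flat : g '' (LowDim.cube n ∩ LowDim.coordPlane n m) = U₀ ∩ Γ₀)
    (P : LowDim.Eucl n → LowDim.Eucl n) (hP : LowDim.IsMetricProjectionOn Γ₀ U₀ P)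
    (hg_proj : ∀ v ∈ LowDim.cube n, g (LowDim.projPlane n m v) = P (g v))
    -- the derivative bounds
    (hDg : ∀ v ∈ LowDim.cube n, ‖fderiv ℝ g v‖ ≤ K₀)
    (hDginv : ∀ x ∈ U₀, ‖fderiv ℝ ginv x‖ ≤ K₀)
    (hD2g : ∀ v ∈ LowDim.cube n, LowDim.secondDerivNorm g v ≤ 1 / 2 * K₀⁻¹)
    -- only in codimension at least 16
    (hcodim : m + 16 ≤ n → ∃ κ : ℝ, κ * √((n : ℝ) - m) < 2 * K₀⁻¹ ∧
      ∀ v ∈ LowDim.cube n, LowDim.secondDerivNorm g v ≤ κ)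
    -- the growth condition on the weight
    (hγ_growth : ∀ x ∈ U₀ \ Γ₀,
      1 ≤ Metric.infDist x Γ₀ ^ β * γ₀ x ∧ Metric.infDist x Γ₀ ^ β * γ₀ x ≤ K₃) :
    ∃ b₀ θ₀ : ℝ, 0 < b₀ ∧ b₀ < 1 / √((n : ℝ) - m) ∧ 0 < θ₀ ∧ θ₀ < Real.pi / 4 ∧
      ∀ b θ : ℝ, 0 < b → b ≤ b₀ → 0 < θ → θ ≤ θ₀ →
        (∀ x ∈ U₀ \ Γ₀,
          0 < volume (LowDim.transCorr n m g ginv b θ x) ∧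
          (volume (LowDim.transCorr n m g ginv b θ x))⁻¹ ≤
            ENNReal.ofReal ((n : ℝ) ^ ((n : ℝ) / 2) * K₀ ^ n) *
              (volume (LowDim.flatCorr n m b θ (ginv x)))⁻¹ ∧
          LowDim.transCorr n m g ginv b θ x ⊆ Metric.ball x (Metric.infDist x Γ₀)) ∧
        (∀ y ∈ U₀ \ Γ₀,
          ∫⁻ x in LowDim.corrInv (U₀ \ Γ₀) (LowDim.transCorr n m g ginv b θ) y,
              ENNReal.ofReal (γ₀ x) / volume (LowDim.transCorr n m g ginv b θ x) ≤
            ENNReal.ofReal (ν * γ₀ y)) := by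
  obtain ⟨κ, hκ0, hκ, hκg⟩ := exists_secondDeriv_bound hK₀ hD2g hcodim
  have H : IsFlatChart n m Γ₀ U₀ g ginv K₀ κ :=
    { lt := hm, one_le := hK₀, nonneg := hκ0, small := hκ, isOpen := hU_open, bijOn := hg_bij
      invOn := hg_inv, contDiffOn := hg_smooth, contDiffOn_inv := hginv_smooth, flat := hg_flat
      infDist_eq := fun v hv => by
        rw [hg_proj v hv, (hP _ (hg_bij.mapsTo hv)).2]
      norm_fderiv_le := hDg, norm_fderiv_inv_le := hDginv, secondDeriv_le := hκg }
  have hK := zero_lt_one.trans_le hK₀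
  have hc := H.expansion_pos
  have hc1 : expansion n m K₀ κ ≤ 1 := H.expansion_le.trans (inv_le_one_of_one_le₀ hK₀)
  have hn1 : (1 : ℝ) ≤ n := by exact_mod_cast (Nat.zero_le m).trans_lt hm
  have hs1 : 1 ≤ √((n : ℝ) - m) := by
    rw [Real.one_le_sqrt]
    have : (m : ℝ) + 1 ≤ n := by exact_mod_cast hm
    linarith
  have hs0 : 0 < √((n : ℝ) - m) := one_pos.trans_le hs1
  have hK3 : 1 ≤ K₀ ^ 3 := one_le_pow₀ hK₀
  -- `max K₃ 1` is positive also when `U₀ \ Γ₀` carries no information on `K₃`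
  set K₄ := max K₃ 1
  have hK₄ : 0 < K₄ := one_pos.trans_le (le_max_right _ _)
  set C := 2 * K₄ * expansion n m K₀ κ ^ (-β) * 4 ^ n * K₀ ^ (2 * n) * K₀ ^ β with hC
  have hC0 : 0 < C := by positivity
  have hβn : 0 < β - n := sub_pos.2 hβ
  refine ⟨min (1 / (2 * √((n : ℝ) - m))) (min (expansion n m K₀ κ / (8 * K₀ ^ 3))
    ((ν / C) ^ (β - n)⁻¹)), expansion n m K₀ κ / (4 * K₀ ^ 3), by positivity, ?_,
    by positivity, ?_, ?_⟩
  · refine (min_le_left _ _).trans_lt ?_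
    exact one_div_lt_one_div_of_lt hs0 (by linarith)
  · rw [div_lt_iff₀ (by positivity)]
    nlinarith [Real.pi_gt_three]
  intro b θ hb hbb hθ hθθ
  obtain ⟨hb1, hb2, hb3⟩ : b ≤ 1 / (2 * √((n : ℝ) - m)) ∧
      b ≤ expansion n m K₀ κ / (8 * K₀ ^ 3) ∧ b ≤ (ν / C) ^ (β - n)⁻¹ := by
    simpa only [le_min_iff] using hbb
  have hbs : b * √((n : ℝ) - m) ≤ 1 / 2 := by
    rw [le_div_iff₀ (by positivity)] at hb1; linarith
  have hb_one : b ≤ 1 := by nlinarith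
  have hθ1 : θ ≤ 1 := by
    refine hθθ.trans ?_
    rw [div_le_one (by positivity)]; linarith
  have hcos : 1 / 2 ≤ Real.cos θ := by
    have := Real.one_sub_sq_div_two_le_cos (x := θ)
    nlinarith
  have hcos1 : Real.cos θ < 1 := by
    rw [← Real.cos_zero]
    exact Real.cos_lt_cos_of_nonneg_of_le_pi le_rfl (by linarith [Real.pi_gt_three]) hθ
  have hbC : C * b ^ (β - n) ≤ ν := by
    have h1 := Real.rpow_le_rpow hb.le hb3 hβn.le
    rw [← Real.rpow_mul (by positivity), inv_mul_cancel₀ hβn.ne', Real.rpow_one,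
      le_div_iff₀ hC0] at h1
    linarith
  refine ⟨fun x hx => ?_, fun y hy => ?_⟩
  · obtain ⟨hv, hvG, hgv⟩ := H.ginv_mem hx
    have hvol := H.volume_flatCorr_le (b := b) (θ := θ) (by linarith) x
    have hpos : 0 < volume (flatCorr n m b θ (ginv x)) := by
      have h1 := volume_truncCone_le_flatCorr (b := b) hcos hv hvG
        ((mul_le_mul_of_nonneg_left (norm_perp_le_sqrt hm hv) hb.le).trans hbs)
      have hk := norm_pos_iff.2 (perp_ne_zero hvG)
      have h2 := (volume_truncCone_pos hcos1 (norm_direction (perp_ne_zero hvG))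
        (perp_direction_perp _) (mul_pos hb hk)).trans_le h1
      exact pos_of_mul_pos_right h2 zero_le
    refine ⟨pos_of_mul_pos_right (hpos.trans_le hvol) zero_le, ?_, ?_⟩
    · have hKn : K₀ ^ n ≤ (n : ℝ) ^ ((n : ℝ) / 2) * K₀ ^ n :=
        le_mul_of_one_le_left (by positivity) (Real.one_le_rpow hn1 (by positivity))
      refine ennreal_inv_le_mul_inv (ENNReal.ofReal_pos.2 (by positivity)).ne'
        ENNReal.ofReal_ne_top (hvol.trans ?_)
      gcongr
    · rintro _ ⟨w, hw, rfl⟩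
      have := H.transCorr_subset_ball hb hb2 hθ.le hθθ hcos hv hvG hw
      rwa [hgv] at this
  · obtain ⟨hw, hwG, hgw⟩ := H.ginv_mem hy
    have hint := H.setLIntegral_corrInv_le (γ := γ₀) (hn1.trans hβ.le) hK₄.le hb hb_one hbs hcos
      hcos1 (fun x hx => (hγ_growth x hx).2.trans (le_max_left _ _)) hw hwG
    rw [hgw] at hint
    refine hint.trans (ENNReal.ofReal_le_ofReal ?_)
    have hk := norm_pos_iff.2 (perp_ne_zero hwG)
    set k := ‖perp n m (ginv y)‖
    have hγy : k ^ (-β) ≤ K₀ ^ β * γ₀ y := by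
      have h1 := (hγ_growth y hy).1
      have h2 : Metric.infDist y Γ₀ ≤ K₀ * k := by
        have := H.infDist_le hw
        rwa [hgw] at this
      have h3 : Metric.infDist y Γ₀ ^ β ≤ K₀ ^ β * k ^ β := by
        rw [← Real.mul_rpow hK.le hk.le]
        exact Real.rpow_le_rpow Metric.infDist_nonneg h2 (by linarith)
      have h4 := h1.trans (mul_le_mul_of_nonneg_right h3 (hγ_nonneg y hy.2))
      rw [Real.rpow_neg hk.le, inv_le_iff_one_le_mul₀ (by positivity)]
      linarith
    calc _ ≤ 2 * K₄ * expansion n m K₀ κ ^ (-β) * 4 ^ n * K₀ ^ (2 * n) * b ^ (β - n) *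
          (K₀ ^ β * γ₀ y) := by gcongr
      _ = C * b ^ (β - n) * γ₀ y := by rw [hC]; ring
      _ ≤ ν * γ₀ y := mul_le_mul_of_nonneg_right hbC (hγ_nonneg y hy.2)
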